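/- Let $D$ be an oriented regular (virtual) link diagram: finitely many oriented, piecewise smooth, closed curves in the plane that meet themselves and each other only in finitely many transverse double points, the crossings, each of which is classical or virtual; at each classical crossing one of the two passages is the overpassing one. The directed universe $\vec U$ of $D$ has the classical crossings as vertices, the oriented arcs of $D$ from one passage of a classical crossing to the next as edges, and one free loop for each link component without classical crossings. A directed Euler system $C$ of $\vec U$ consists of one directed Euler circuit for each connected component of $\vec U$ (together with all the free loops). The looped interlacement graph $\mathcal L(D,C)$ has the classical crossings as vertices; two different vertices $v,w$ are adjacent iff they are interlaced, i.e. appear in the order $v\dots w\dots v\dots w$ on a circuit of $C$; the looped vertices are the negative crossings; the marked vertices are the crossings at which $C$ does not follow the incident link component(s); and the number of free loops of $\mathcal L(D,C)$ is the number of connected components of $\vec U$ (free loops included) minus one. The vertices carry arbitrary weights $\alpha,\beta$ in a commutative ring $R$, in which two elements $A,B$ are given as standard weights. A marked, weighted graph $G$ is the composition $F*H$ if $V(F)\cap V(H)$ consists of a single unlooped, unmarked vertex $a$ with weights $\alpha(a)=A$, $\beta(a)=B$ in both $F$ and $H$; $V(G)=(V(F)\cup V(H))\setminus\{a\}$, with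 loops, marks and weights inherited from $F$ and $H$; $E(G)=E(F-a)\cup E(H-a)\cup\{\{v,w\} : \{v,a\}\in E(F),\ \{a,w\}\in E(H)\}$; and the free loops of $G$ are those of $F$ together with those of $H$, no free loop being shared. Suppose $D$ contains a 2-tangle, i.e. there is a simple closed curve in the plane that meets $D$ in precisely four points, none of which is a crossing; a crossing is inside the tangle if it lies in a bounded component of the complement of this curve, and outside if it lies in the unbounded one. (1) For every directed Euler system $C$ of $\vec U$ (and all weights) there are marked, weighted graphs $F$ and $H$ with a common vertex $a$ such that $\mathcal L(D,C)=F*H$, $F-a$ is the subgraph of $\mathcal L(D,C)$ induced by the classical crossings outside the tangle, and $H-a$ is the subgraph of $\mathcal L(D,C)$ induced by the classical crossings inside the tangle. (2) There is a directed Euler system $C$ of $\vec U$ such that, for all weights and for all $F,H,a$ as in (1), at least one of $F,H$ has no marked vertex adjacent to $a$. -/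

import Mathlib

universe u v

noncomputable section

/-! ### Directed multigraphs with free loops, and directed Euler systems -/

/-- A directed graph in which loops and multiple edges are allowed, and which may also have
free loops (connected components with neither vertices nor edges). -/
structure FLDigraph where
  /-- vertices -/
  V : Type
  /-- edges -/
  E : Type
  /-- free loops -/
  L : Type
  /-- the initial vertex of an edge -/
  tail : E → V
  /-- the terminal vertex of an edge -/
  head : E → V

namespace FLDigraph

/-- The connected components, other than free loops, of the underlying undirected graph. -/
def Component (U : FLDigraph) : Type :=
  Quot fun x y : U.V => ∃ e : U.E, U.tail e = x ∧ U.head e = y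

/-- The connected component that contains a given vertex. -/
def component (U : FLDigraph) (x : U.V) : U.Component := Quot.mk _ x

/-- The number of connected components, free loops included. -/
def numComponents (U : FLDigraph) : ℕ := Nat.card U.Component + Nat.card U.L

/-- A directed Euler system: one directed Euler circuit for each connected component, i.e. a
cyclic sequence of edges, each one ending where the next one begins, that contains every edge of
the component exactly once and no other edge. (The free loops also belong to the system; as
they all do, this involves no choice.) -/
structure EulerSystem (U : FLDigraph) where
  /-- the Euler circuit of a component -/
  circuit : U.Component → Cycle U.E
  /-- every edge ends where the next one begins -/
  chain : ∀ c, (circuit c).Chain fun e f => U.head e = U.tail f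
  /-- no edge is repeated -/
  nodup : ∀ c, (circuit c).Nodup
  /-- the edges of the circuit are the edges of the component -/
  mem_iff : ∀ c e, e ∈ circuit c ↔ U.component (U.tail e) = c

namespace EulerSystem

variable {U : FLDigraph}

/-- Two vertices are interlaced if on some circuit they appear in the order `x … y … x … y`. -/
def Interlaced (C : U.EulerSystem) (x y : U.V) : Prop :=
  x ≠ y ∧ ∃ (c : U.Component) (l : List U.E),
    (l : Cycle U.E) = C.circuit c ∧ List.Sublist [x, y, x, y] (l.map U.tail)

theorem Interlaced.symm {C : U.EulerSystem} {x y : U.V} (h : C.Interlaced x y) :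
    C.Interlaced y x := by
  obtain ⟨hne, c, l, hl, hs⟩ := h
  refine ⟨hne.symm, c, ?_⟩
  have hs' : List.Sublist ([x] ++ [y, x, y]) (l.map U.tail) := hs
  obtain ⟨m₁, m₂, hm, h₁, h₂⟩ := List.append_sublist_iff.1 hs'
  obtain ⟨l₁, l₂, rfl, rfl, rfl⟩ := List.map_eq_append_iff.1 hm
  refine ⟨l₂ ++ l₁, ?_, ?_⟩
  · rw [← hl]
    exact Cycle.coe_eq_coe.2 List.isRotated_append
  · rw [List.map_append]
    exact List.Sublist.append h₂ h₁

/-- The edge `f` comes immediately after the edge `e` on a circuit of the system. -/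
def Follows (C : U.EulerSystem) (e f : U.E) : Prop :=
  ∃ (c : U.Component) (l : List U.E),
    ((e :: l : List U.E) : Cycle U.E) = C.circuit c ∧ (l ++ [e]).head? = some f

end EulerSystem

end FLDigraph

/-! ### Marked, weighted graphs and their compositions -/

/-- A finite marked, weighted graph whose vertices lie in a type `X` and whose weights lie in
`R`. Loops are recorded by the set of looped vertices; `Adj` is adjacency of different
vertices. Values of the weights off the vertex set have no meaning. -/
structure MarkedGraph (X : Type u) (R : Type v) where
  /-- the vertex set -/
  verts : Set X
  finite_verts : verts.Finite
  /-- adjacency of two different vertices -/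
  Adj : X → X → Prop
  adj_symm : ∀ {x y}, Adj x y → Adj y x
  adj_irrefl : ∀ x, ¬ Adj x x
  left_mem : ∀ {x y}, Adj x y → x ∈ verts
  /-- the looped vertices -/
  looped : Set X
  looped_subset : looped ⊆ verts
  /-- the marked vertices -/
  marked : Set X
  marked_subset : marked ⊆ verts
  /-- the number of free loops -/
  freeLoops : ℕ
  /-- the weights `α` -/
  wα : X → R
  /-- the weights `β` -/
  wβ : X → R

namespace MarkedGraph

variable {X : Type u} {R : Type v}

/-- The graph `G - a`. -/
def deleteVert (G : MarkedGraph X R) (a : X) : MarkedGraph X R where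
  verts := G.verts \ {a}
  finite_verts := G.finite_verts.subset Set.sdiff_subset
  Adj x y := G.Adj x y ∧ x ≠ a ∧ y ≠ a
  adj_symm h := ⟨G.adj_symm h.1, h.2.2, h.2.1⟩
  adj_irrefl x h := G.adj_irrefl x h.1
  left_mem h := ⟨G.left_mem h.1, h.2.1⟩
  looped := G.looped \ {a}
  looped_subset := Set.sdiff_subset_sdiff_left G.looped_subset
  marked := G.marked \ {a}
  marked_subset := Set.sdiff_subset_sdiff_left G.marked_subset
  freeLoops := G.freeLoops
  wα := G.wα
  wβ := G.wβ

/-- `K` is the subgraph of `G` induced by the vertices of `G` that lie in `S`, with the loops,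
marks and weights of `G`. (Free loops are not incident on any vertex, so a subgraph induced by
a set of vertices may have any part of them.) -/
structure IsInducedSubgraph (K G : MarkedGraph X R) (S : Set X) : Prop where
  verts_eq : K.verts = G.verts ∩ S
  adj_iff : ∀ x ∈ K.verts, ∀ y ∈ K.verts, (K.Adj x y ↔ G.Adj x y)
  looped_iff : ∀ x ∈ K.verts, (x ∈ K.looped ↔ x ∈ G.looped)
  marked_iff : ∀ x ∈ K.verts, (x ∈ K.marked ↔ x ∈ G.marked)
  wα_eq : ∀ x ∈ K.verts, K.wα x = G.wα x
  wβ_eq : ∀ x ∈ K.verts, K.wβ x = G.wβ x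
  freeLoops_le : K.freeLoops ≤ G.freeLoops

/-- `a` is an unlooped, unmarked vertex of `G` with the standard weights `A` and `B`. -/
structure IsStandardVertex (G : MarkedGraph X R) (A B : R) (a : X) : Prop where
  mem : a ∈ G.verts
  not_looped : a ∉ G.looped
  not_marked : a ∉ G.marked
  wα_eq : G.wα a = A
  wβ_eq : G.wβ a = B

/-- `G` is the composition `F ∗ H` along the vertex `a`, where `A` and `B` are the standard
weights. -/
structure IsComposition (G F H : MarkedGraph X R) (A B : R) (a : X) : Prop where
  inter_eq : F.verts ∩ H.verts = {a}
  left_standard : F.IsStandardVertex A B a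
  right_standard : H.IsStandardVertex A B a
  verts_eq : G.verts = (F.verts ∪ H.verts) \ {a}
  left_looped : ∀ x ∈ F.verts \ {a}, (x ∈ G.looped ↔ x ∈ F.looped)
  right_looped : ∀ x ∈ H.verts \ {a}, (x ∈ G.looped ↔ x ∈ H.looped)
  left_marked : ∀ x ∈ F.verts \ {a}, (x ∈ G.marked ↔ x ∈ F.marked)
  right_marked : ∀ x ∈ H.verts \ {a}, (x ∈ G.marked ↔ x ∈ H.marked)
  left_wα : ∀ x ∈ F.verts \ {a}, G.wα x = F.wα x
  right_wα : ∀ x ∈ H.verts \ {a}, G.wα x = H.wα x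
  left_wβ : ∀ x ∈ F.verts \ {a}, G.wβ x = F.wβ x
  right_wβ : ∀ x ∈ H.verts \ {a}, G.wβ x = H.wβ x
  adj_iff : ∀ x y, G.Adj x y ↔
    (F.deleteVert a).Adj x y ∨ (H.deleteVert a).Adj x y ∨
      (F.Adj x a ∧ H.Adj a y) ∨ (F.Adj y a ∧ H.Adj a x)
  freeLoops_eq : G.freeLoops = F.freeLoops + H.freeLoops

/-- No marked vertex of `G` is adjacent to `a`. -/
def NoMarkedNeighbor (G : MarkedGraph X R) (a : X) : Prop :=
  ∀ x ∈ G.marked, ¬ G.Adj x a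

end MarkedGraph

/-! ### Link diagrams -/

/-- The Euclidean plane. -/
abbrev Plane : Type := EuclideanSpace ℝ (Fin 2)

/-- The determinant of two plane vectors. -/
def planeDet (x y : Plane) : ℝ := x 0 * y 1 - x 1 * y 0

/-- An oriented regular (virtual) link diagram: finitely many oriented, piecewise smooth, closed
curves in the plane that meet themselves and each other only in finitely many transverse double
points, the crossings. Some crossings are classical, the others are virtual; at every classical
crossing one of the two passages is the overpassing one. -/
structure LinkDiagram where
  /-- the number of link components -/
  n : ℕ
  /-- the closed curves; the orientation is the direction of increasing parameter -/
  curve : Fin n → UnitAddCircle → Plane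
  continuous_curve : ∀ i, Continuous (curve i)
  /-- there is a finite set of break points, and the curve is continuously differentiable, up to
  the end points, on every closed interval without break points in its interior -/
  piecewise_smooth : ∀ i, ∃ s : Finset ℝ, ∀ a b : ℝ, 0 ≤ a → a < b → b ≤ 1 →
    (∀ t ∈ s, t ∉ Set.Ioo a b) →
      ContDiffOn ℝ 1 (fun t : ℝ => curve i (t : UnitAddCircle)) (Set.Icc a b)
  /-- only finitely many points of the plane are passed more than once -/
  finite_crossings : {x : Plane | ∃ p q : Fin n × UnitAddCircle,
    p ≠ q ∧ curve p.1 p.2 = x ∧ curve q.1 q.2 = x}.Finite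
  /-- no point is passed more than twice -/
  double : ∀ p q r : Fin n × UnitAddCircle, curve p.1 p.2 = curve q.1 q.2 →
    curve q.1 q.2 = curve r.1 r.2 → p = q ∨ q = r ∨ p = r
  /-- at a crossing both passages are differentiable, with linearly independent velocities (both
  derivatives are nonzero by this condition, hence they exist) -/
  transverse : ∀ p q : Fin n × UnitAddCircle, p ≠ q → curve p.1 p.2 = curve q.1 q.2 →
    planeDet (deriv (fun t : ℝ => curve p.1 (p.2 + (t : UnitAddCircle))) 0)
      (deriv (fun t : ℝ => curve q.1 (q.2 + (t : UnitAddCircle))) 0) ≠ 0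
  /-- the classical crossings -/
  classical : Set Plane
  classical_subset : classical ⊆ {x : Plane | ∃ p q : Fin n × UnitAddCircle,
    p ≠ q ∧ curve p.1 p.2 = x ∧ curve q.1 q.2 = x}
  /-- the overpassing passages (this matters only at classical crossings) -/
  overpass : Set (Fin n × UnitAddCircle)
  overpass_iff : ∀ p q : Fin n × UnitAddCircle, p ≠ q → curve p.1 p.2 = curve q.1 q.2 →
    curve p.1 p.2 ∈ classical → (p ∈ overpass ↔ q ∉ overpass)

namespace LinkDiagram

/-- A passage: a parameter value on one of the closed curves. -/
abbrev Passage (D : LinkDiagram) : Type := Fin D.n × UnitAddCircle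

/-- The point of the plane that belongs to a parameter value. -/
def pt (D : LinkDiagram) (p : D.Passage) : Plane := D.curve p.1 p.2

/-- The velocity of the curve at a parameter value. -/
def velocity (D : LinkDiagram) (p : D.Passage) : Plane :=
  deriv (fun t : ℝ => D.pt (p.1, p.2 + (t : UnitAddCircle))) 0

/-- The set of all crossings, classical and virtual. -/
def crossings (D : LinkDiagram) : Set Plane := {x | ∃ p q, p ≠ q ∧ D.pt p = x ∧ D.pt q = x}

/-- The negative crossings: the classical crossings at which the velocities of the overpassing
and the underpassing strand, in this order, form a negatively oriented basis of the plane. -/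
def negative (D : LinkDiagram) : Set Plane :=
  {x | x ∈ D.classical ∧ ∃ p q, D.pt p = x ∧ D.pt q = x ∧ p ∈ D.overpass ∧ q ∉ D.overpass ∧
    planeDet (D.velocity p) (D.velocity q) < 0}

/-- `D.IsArc p q`: following the orientation from the passage `p` of a classical crossing, the
first passage of a classical crossing that is reached is `q` (which is `p` itself if the link
component has no other one). Virtual crossings on the way are ignored. -/
def IsArc (D : LinkDiagram) (p q : D.Passage) : Prop :=
  D.pt p ∈ D.classical ∧ D.pt q ∈ D.classical ∧ q.1 = p.1 ∧
    ∃ s : ℝ, 0 < s ∧ s ≤ 1 ∧ q.2 = p.2 + (s : UnitAddCircle) ∧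
      ∀ r : ℝ, 0 < r → r < s → D.pt (p.1, p.2 + (r : UnitAddCircle)) ∉ D.classical

/-- The directed universe: the vertices are the classical crossings, the edges are the arcs
from one passage of a classical crossing to the next, and there is a free loop for each link
component without classical crossings. -/
def directedUniverse (D : LinkDiagram) : FLDigraph where
  V := D.classical
  E := {e : D.Passage × D.Passage // D.IsArc e.1 e.2}
  L := {i : Fin D.n // ∀ t, D.pt (i, t) ∉ D.classical}
  tail e := ⟨D.pt e.1.1, e.2.1⟩
  head e := ⟨D.pt e.1.2, e.2.2.1⟩

/-- A directed Euler system for the universe of `D`. -/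
abbrev EulerSystem (D : LinkDiagram) : Type := D.directedUniverse.EulerSystem

/-- The marked crossings: those at which the Euler system does not follow the incident link
component(s), that is, where some edge of a circuit arrives through one passage of the crossing
and the next edge leaves through the other passage. -/
def markedCrossings (D : LinkDiagram) (C : D.EulerSystem) : Set Plane :=
  {x | ∃ e f : D.directedUniverse.E, C.Follows e f ∧ D.pt e.1.2 = x ∧ e.1.2 ≠ f.1.1}

theorem markedCrossings_subset (D : LinkDiagram) (C : D.EulerSystem) :
    D.markedCrossings C ⊆ D.classical := by
  rintro x ⟨e, f, -, rfl, -⟩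
  exact e.2.2.1

/-- The looped interlacement graph `𝓛(D, C)`, with weights `α`, `β` for the classical crossings.
Its vertices are the classical crossings, the marked vertices are the marked crossings, the
looped vertices are the negative crossings, and two vertices are adjacent if and only if they
are interlaced with respect to `C`. It has one free loop less than the universe of `D` has
connected components. -/
def interlacementGraph (D : LinkDiagram) (C : D.EulerSystem) {R : Type v} (α β : Plane → R) :
    MarkedGraph Plane R where
  verts := D.classical
  finite_verts := D.finite_crossings.subset D.classical_subset
  Adj x y := ∃ (hx : x ∈ D.classical) (hy : y ∈ D.classical), C.Interlaced ⟨x, hx⟩ ⟨y, hy⟩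
  adj_symm := fun ⟨hx, hy, h⟩ => ⟨hy, hx, h.symm⟩
  adj_irrefl := fun _ ⟨_, _, h⟩ => h.1 rfl
  left_mem := fun ⟨hx, _, _⟩ => hx
  looped := D.negative
  looped_subset := fun _ h => h.1
  marked := D.markedCrossings C
  marked_subset := D.markedCrossings_subset C
  freeLoops := D.directedUniverse.numComponents - 1
  wα := α
  wβ := β

/-- A 2-tangle in `D`, given by its boundary: a (topological) circle in the plane that intersects
`D` in precisely four points, none of which is a crossing. -/
structure Tangle (D : LinkDiagram) where
  /-- the boundary circle -/
  boundary : Set Plane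
  isCircle : ∃ J : UnitAddCircle → Plane,
    Continuous J ∧ Function.Injective J ∧ Set.range J = boundary
  four_points : (boundary ∩ Set.range D.pt).encard = 4
  not_crossing : Disjoint boundary D.crossings

namespace Tangle

variable {D : LinkDiagram}

/-- The points enclosed by the boundary circle: those that lie in a bounded component of its
complement. -/
def inside (T : D.Tangle) : Set Plane :=
  {x | x ∉ T.boundary ∧ Bornology.IsBounded (connectedComponentIn T.boundaryᶜ x)}

/-- The points outside the boundary circle. -/
def outside (T : D.Tangle) : Set Plane :=
  {x | x ∉ T.boundary ∧ ¬ Bornology.IsBounded (connectedComponentIn T.boundaryᶜ x)}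

end Tangle

/-- `F` and `H` decompose `𝓛(D, C)` along the tangle `T`: `𝓛(D, C) = F ∗ H` with common vertex
`a`, and `F - a`, `H - a` are the subgraphs of `𝓛(D, C)` induced by the crossings outside and
inside `T` respectively. -/
structure IsTangleDecomposition (D : LinkDiagram) (T : D.Tangle) (C : D.EulerSystem)
    {R : Type v} (A B : R) (α β : Plane → R) (F H : MarkedGraph Plane R) (a : Plane) : Prop where
  composition : (D.interlacementGraph C α β).IsComposition F H A B a
  outside_induced :
    (F.deleteVert a).IsInducedSubgraph (D.interlacementGraph C α β) T.outside
  inside_induced :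
    (H.deleteVert a).IsInducedSubgraph (D.interlacementGraph C α β) T.inside

end LinkDiagram

end

/-! ### Cycles of permutations multiplied by a transposition -/

namespace Equiv.Perm

variable {E : Type*}

/-! For the first claim, an arc of the universe that joins a crossing inside the tangle to one
outside must meet the boundary circle. The four boundary points are not crossings, so each lies on
at most one arc, and at most four arcs are mixed (`Tangle.encard_mixed_le`). No Jordan curve theorem
is needed: a connected set off the circle stays in one component of the complement. If `v` inside
and `w` outside are interlaced, their circuit changes side four times, so it uses all mixed arcs and
splits into two inner and two outer blocks, with `v` once in each inner and `w` once in each outer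
block. Every other interlaced inside-outside pair lies on the same circuit in the same pattern. The
interlacements across the tangle therefore form a complete bipartite graph (`Interlaced.of_cut`),
which is what a composition along an apex `a` encodes (`isComposition_coneOver`).

For the second claim it suffices that no two marked crossings are interlaced: a marked neighbour of
`a` in `F` and one in `H` would become adjacent in the composition. Such an Euler system exists
independently of the tangle. Start from the permutation of the arcs that follows the link
components. As long as the two arcs leaving some crossing lie in different cycles, merge these by a
transposition. Each merge joins two cycles, so the changed crossings form a forest on the link
components. Undoing one merge splits a circuit without separating the two visits to any other
changed crossing, whereas an interlaced crossing would be separated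
(`IsForestTransition.not_interlaced`). -/

theorem SameCycle.of_forall_apply [Finite E] {φ : Perm E} {r : E → E → Prop}
    (hr : Equivalence r) (h : ∀ x, r x (φ x)) {x y : E} (hxy : φ.SameCycle x y) : r x y := by
  obtain ⟨n, rfl⟩ := hxy.exists_nat_pow_eq
  clear hxy
  induction n with
  | zero => exact hr.refl x
  | succ n ih =>
    rw [pow_succ', mul_apply]
    exact hr.trans ih (h _)

theorem SameCycle.mem_of_forall_apply_mem [Finite E] {φ : Perm E} {S : Set E}
    (h : ∀ x ∈ S, φ x ∈ S) {x y : E} (hxy : φ.SameCycle x y) (hx : x ∈ S) : y ∈ S := by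
  obtain ⟨n, rfl⟩ := hxy.exists_nat_pow_eq
  clear hxy
  induction n with
  | zero => exact hx
  | succ n ih =>
    rw [pow_succ', mul_apply]
    exact h _ ih

variable [DecidableEq E]

/-- Swapping targets within one cycle never leaves that cycle, so the cycles can only get finer. -/
theorem SameCycle.of_swap_mul [Finite E] {φ : Perm E} {e e' x y : E} (he : φ.SameCycle e e')
    (h : (swap e e' * φ).SameCycle x y) : φ.SameCycle x y := by
  refine SameCycle.of_forall_apply (SameCycle.equivalence φ) (fun z => ?_) h
  have hz : φ.SameCycle z (φ z) := sameCycle_apply_right.2 (SameCycle.refl φ z)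
  rw [mul_apply, swap_apply_def]
  split_ifs with h₁ h₂
  · exact (h₁ ▸ hz).trans he
  · exact (h₂ ▸ hz).trans he.symm
  · exact hz

/-- Starting at `g`, the product follows the cycle of `φ` until this would close up at `g`, and
there it is diverted to `g'`. -/
theorem sameCycle_swap_mul_self [Finite E] {φ : Perm E} {g g' : E} (h : ¬ φ.SameCycle g g') :
    (swap g g' * φ).SameCycle g g' := by
  set ψ := swap g g' * φ with hψ
  by_contra hc
  have key : φ.symm g ∈ {x | φ.SameCycle g x ∧ ψ.SameCycle g x} := by
    refine SameCycle.mem_of_forall_apply_mem (φ := φ) (x := g) ?_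
      (sameCycle_symm_apply_right.2 (SameCycle.refl φ g)) ⟨SameCycle.refl _ _, SameCycle.refl _ _⟩
    rintro x ⟨hx₁, hx₂⟩
    refine ⟨sameCycle_apply_right.2 hx₁, ?_⟩
    have h₁ : ψ.SameCycle g (ψ x) := sameCycle_apply_right.2 hx₂
    rw [hψ, mul_apply, swap_apply_def] at h₁
    split_ifs at h₁ with h₂ h₃
    · exact absurd h₁ hc
    · exact absurd (h₃ ▸ sameCycle_apply_right.2 hx₁) h
    · exact h₁
  have := sameCycle_apply_right.2 key.2
  rw [hψ, mul_apply, apply_symm_apply, swap_apply_left] at this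
  exact hc this

/-- The two maps differ only where `g` and `g'` are exchanged as values, and these are now in one
cycle; merging therefore only coarsens the cycles. -/
theorem SameCycle.swap_mul [Finite E] {φ : Perm E} {g g' x y : E} (h : ¬ φ.SameCycle g g')
    (hxy : φ.SameCycle x y) : (swap g g' * φ).SameCycle x y := by
  have hs := sameCycle_swap_mul_self h
  refine SameCycle.of_forall_apply (SameCycle.equivalence _) (fun z => ?_) hxy
  have h₁ : (swap g g' * φ).SameCycle z ((swap g g' * φ) z) :=
    sameCycle_apply_right.2 (SameCycle.refl _ z)
  rw [mul_apply, swap_apply_def] at h₁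
  split_ifs at h₁ with h₂ h₃
  · rw [h₂]; exact h₁.trans hs.symm
  · rw [h₃]; exact h₁.trans hs
  · exact h₁

end Equiv.Perm

/-! ### Cyclic sequences indexed by the integers -/

namespace Cycle

variable {α : Type*}

/-- `g` runs through the cyclic sequence `s` of length `n` periodically, without repetition
within a period, and consecutive values satisfy `r`. -/
structure IsParam (r : α → α → Prop) (s : Cycle α) (n : ℕ) (g : ℤ → α) : Prop where
  rel : ∀ i, r (g i) (g (i + 1))
  periodic : ∀ i, g (i + n) = g i
  inj : ∀ i j : ℤ, i ≤ j → j < i + n → g i = g j → i = j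
  exists_shift : ∀ l : List α, (l : Cycle α) = s →
    l.length = n ∧ ∃ k : ℤ, ∀ (i : ℕ) (h : i < l.length), l[i] = g (i + k)
  exists_list : ∀ k : ℤ, ∃ l : List α, (l : Cycle α) = s ∧ l.length = n ∧
    ∀ (i : ℕ) (h : i < l.length), l[i] = g (i + k)
  mem : ∀ i, g i ∈ s

theorem exists_isParam {r : α → α → Prop} {s : Cycle α} (hs : s.Chain r) (hn : s.Nodup)
    (hne : s ≠ nil) : ∃ n g, 0 < n ∧ IsParam r s n g := by
  obtain ⟨l, rfl⟩ : ∃ l : List α, (l : Cycle α) = s := Quot.exists_rep s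
  have hl : l ≠ [] := by rintro rfl; exact hne rfl
  have hpos : 0 < l.length := List.length_pos_of_ne_nil hl
  have hpos' : (0 : ℤ) < l.length := by exact_mod_cast hpos
  have hlt : ∀ i : ℤ, (i % (l.length : ℤ)).toNat < l.length := fun i => by
    have := Int.emod_lt_of_pos i hpos'
    have := Int.emod_nonneg i hpos'.ne'
    omega
  have hnd : l.Nodup := hn
  set g : ℤ → α := fun i => l[(i % (l.length : ℤ)).toNat]'(hlt i) with hg
  have hgeq : ∀ (i : ℤ) (m : ℕ) (h : m < l.length), i % (l.length : ℤ) = m → g i = l[m] := by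
    intro i m h hi
    simp [hg, hi]
  have hrot : ∀ k : ℕ, ∀ (i : ℕ) (h : i < (l.rotate k).length), (l.rotate k)[i] = g (i + k) := by
    intro k i h
    rw [List.getElem_rotate]
    refine (hgeq _ _ (Nat.mod_lt _ hpos) ?_).symm
    push_cast
    rfl
  have hper : ∀ i, g (i + l.length) = g i := fun i => by simp [hg]
  refine ⟨l.length, g, hpos, ?_, hper, ?_, ?_, ?_, ?_⟩
  · intro i
    obtain ⟨m, hm⟩ : ∃ m : ℕ, i % (l.length : ℤ) = m :=
      Int.eq_ofNat_of_zero_le (Int.emod_nonneg i hpos'.ne')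
    have hml : m < l.length := by
      have := Int.emod_lt_of_pos i hpos'
      omega
    rw [hgeq i m hml hm]
    have hi1 : (i + 1) % (l.length : ℤ) = ((m : ℤ) + 1) % l.length := by
      rw [← hm, Int.emod_add_emod]
    obtain ⟨a, t, rfl⟩ := List.exists_cons_of_ne_nil hl
    -- The cyclic chain condition is a list condition with a second copy of `a` at the end; that
    -- copy supplies the step from the last index back to index `0`.
    rw [Cycle.chain_coe_cons, List.isChain_iff_getElem] at hs
    have := hs m (by simpa using hml)
    by_cases h : m + 1 < (a :: t).length
    · rw [hgeq (i + 1) (m + 1) h (by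
        rw [hi1, Int.emod_eq_of_lt (by omega) (by omega)]; push_cast; rfl)]
      convert this using 1
      · rw [← List.getElem_append_left (bs := [a])]; rfl
      · rw [← List.getElem_append_left (bs := [a])]; rfl
    · have hm1 : m + 1 = (a :: t).length := by omega
      rw [hgeq (i + 1) 0 hpos (by
        rw [hi1]
        have : ((m : ℤ) + 1) = (a :: t).length := by exact_mod_cast hm1
        rw [this]; simp)]
      convert this using 1
      · rw [← List.getElem_append_left (bs := [a])]; rfl
      · have : m = t.length := by simpa using hm1
        subst this
        simp
  · intro i j hij hj h
    have h1 := (List.Nodup.getElem_inj_iff hnd).1 h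
    have := Int.emod_nonneg i hpos'.ne'
    have := Int.emod_nonneg j hpos'.ne'
    have h2 : i % (l.length : ℤ) = j % (l.length : ℤ) := by omega
    have h4 : (l.length : ℤ) ∣ j - i := Int.dvd_of_emod_eq_zero (Int.emod_eq_emod_iff_emod_sub_eq_zero.1 h2.symm)
    have h5 := Int.eq_zero_of_dvd_of_nonneg_of_lt (by omega : (0:ℤ) ≤ j - i) (by omega) h4
    omega
  · intro l' hl'
    obtain ⟨k, rfl⟩ := (Cycle.coe_eq_coe.1 hl').symm
    exact ⟨List.length_rotate l k, k, hrot k⟩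
  · intro k
    obtain ⟨m, hm⟩ : ∃ m : ℕ, k % (l.length : ℤ) = m :=
      Int.eq_ofNat_of_zero_le (Int.emod_nonneg k hpos'.ne')
    refine ⟨l.rotate m, Cycle.coe_eq_coe.2 (List.IsRotated.symm ⟨m, rfl⟩), List.length_rotate l m, ?_⟩
    intro i h
    rw [hrot m i h]
    simp only [hg]
    congr 2
    rw [← hm, Int.add_emod_emod]
  · intro i
    exact Cycle.mem_coe_iff.2 (List.getElem_mem _)

theorem IsParam.eq_of_abs_lt {r : α → α → Prop} {s : Cycle α} {n : ℕ} {g : ℤ → α}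
    (hg : IsParam r s n g) {i j : ℤ} (h₁ : i < j + n) (h₂ : j < i + n) (h : g i = g j) : i = j := by
  rcases le_total i j with hij | hij
  · exact hg.inj i j hij h₂ h
  · exact (hg.inj j i hij h₁ h.symm).symm

theorem IsParam.periodic_mul {r : α → α → Prop} {s : Cycle α} {n : ℕ} {g : ℤ → α}
    (hg : IsParam r s n g) (i m : ℤ) : g (i + m * n) = g i := by
  have h : Function.Periodic g (n : ℤ) := hg.periodic
  exact h.int_mul m i

end Cycle

/-! ### Interlacement read off from integer positions -/

namespace FLDigraph.EulerSystem

variable {U : FLDigraph}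

/-- The parametrization is quantified after the circuit so that two interlaced pairs on one circuit
can be placed on a common `g`. The relation `r` is free because both the incidence relation and the
graph of a permutation are used later. -/
theorem Interlaced.exists_positions {C : U.EulerSystem} {x y : U.V} (h : C.Interlaced x y) :
    ∃ c, C.circuit c ≠ Cycle.nil ∧ ∀ (r : U.E → U.E → Prop) (n : ℕ) (g : ℤ → U.E),
      (C.circuit c).IsParam r n g → ∃ i j k m : ℤ, i < j ∧ j < k ∧ k < m ∧ m < i + n ∧
        U.tail (g i) = x ∧ U.tail (g j) = y ∧ U.tail (g k) = x ∧ U.tail (g m) = y := by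
  obtain ⟨-, c, l, hl, hs⟩ := h
  refine ⟨c, ?_, ?_⟩
  · rw [← hl]
    intro h0
    obtain rfl := (Cycle.coe_eq_nil l).1 h0
    simp at hs
  · intro r n g hg
    obtain ⟨hn, k, hk⟩ := hg.exists_shift l hl
    obtain ⟨f, hf⟩ := List.sublist_iff_exists_fin_orderEmbedding_get_eq.1 hs
    have hlen : ∀ a, (f a : ℕ) < l.length := fun a => by simpa using (f a).2
    have hval : ∀ a, U.tail (g ((f a : ℕ) + k)) = [x, y, x, y].get a := fun a => by
      rw [hf a, ← hk _ (hlen a)]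
      simp
    have h01 : f 0 < f 1 :=
      f.lt_iff_lt.2 (show (0 : Fin 4) < 1 by decide)
    have h12 : f 1 < f 2 :=
      f.lt_iff_lt.2 (show (1 : Fin 4) < 2 by decide)
    have h23 : f 2 < f 3 :=
      f.lt_iff_lt.2 (show (2 : Fin 4) < 3 by decide)
    have h3 := hlen 3
    rw [Fin.lt_def] at h01 h12 h23
    exact ⟨(f 0 : ℕ) + k, (f 1 : ℕ) + k, (f 2 : ℕ) + k, (f 3 : ℕ) + k, by omega, by omega,
      by omega, by omega, hval 0, hval 1, hval 2, hval 3⟩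

theorem interlaced_of_positions {C : U.EulerSystem} {x y : U.V} (hxy : x ≠ y) {c : U.Component}
    {r : U.E → U.E → Prop} {n : ℕ} {g : ℤ → U.E} (hg : (C.circuit c).IsParam r n g)
    {i j k m : ℤ} (hij : i < j) (hjk : j < k) (hkm : k < m) (hmi : m < i + n)
    (hi : U.tail (g i) = x) (hj : U.tail (g j) = y) (hk : U.tail (g k) = x)
    (hm : U.tail (g m) = y) : C.Interlaced x y := by
  obtain ⟨l, hl, hn, hget⟩ := hg.exists_list i
  refine ⟨hxy, c, l, hl, ?_⟩
  rw [List.sublist_iff_exists_fin_orderEmbedding_get_eq]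
  have hlen : (l.map U.tail).length = n := by simpa using hn
  let f : Fin 4 → Fin (l.map U.tail).length :=
    ![⟨0, by omega⟩, ⟨(j - i).toNat, by omega⟩, ⟨(k - i).toNat, by omega⟩,
      ⟨(m - i).toNat, by omega⟩]
  have hf : StrictMono f := by
    rw [Fin.strictMono_iff_lt_succ]
    intro a
    fin_cases a <;> simp [f, Fin.lt_def] <;> omega
  refine ⟨OrderEmbedding.ofStrictMono f hf, ?_⟩
  intro a
  have hval : ∀ b : Fin (l.map U.tail).length, (l.map U.tail).get b = U.tail (g ((b : ℕ) + i)) := by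
    intro b
    simp [hget]
  rw [hval]
  fin_cases a
  · simp [f, hi]
  · simp only [f]
    simp [← hj]
    congr 2
    omega
  · simp [f, ← hk]
    congr 2
    omega
  · simp [f, ← hm]
    congr 2
    omega

end FLDigraph.EulerSystem

namespace FLDigraph

open Equiv Equiv.Perm

variable {U : FLDigraph}

namespace EulerSystem

/-! ### A cut of a directed graph by at most four edges -/

theorem Follows.of_chain {C : U.EulerSystem} {r : U.E → U.E → Prop}
    (hr : ∀ c, (C.circuit c).Chain r) {e f : U.E} (h : C.Follows e f) : r e f := by
  obtain ⟨c, l, hl, hf⟩ := h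
  have := hr c
  rw [← hl, Cycle.chain_coe_cons] at this
  cases hl' : l ++ [e] with
  | nil => simp at hl'
  | cons a t =>
    rw [hl'] at this hf
    obtain rfl : a = f := by simpa using hf
    exact (List.isChain_cons_cons.1 this).1

theorem exists_change {p : ℤ → Prop} {i j : ℤ} (hij : i < j) (h : ¬ (p i ↔ p j)) :
    ∃ k, i ≤ k ∧ k < j ∧ ¬ (p k ↔ p (k + 1)) := by
  by_contra hc
  push Not at hc
  have : ∀ m : ℕ, i + m ≤ j → (p i ↔ p (i + m)) := by
    intro m
    induction m with
    | zero => simp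
    | succ m ih =>
      intro hm
      push_cast at hm ⊢
      rw [ih (by omega), hc (i + m) (by omega) (by omega), add_assoc]
  have h1 := this (j - i).toNat (by omega)
  rw [show i + ((j - i).toNat : ℤ) = j by omega] at h1
  exact h h1

/-- An alternating quadruple within one period must meet all four blocks, so `j₂` and `j₄` fall into
the two different negative blocks. The two alternatives correspond to `j₁` being in the second or in
the fourth block; subtracting `n` brings positions back to the window after `c₁`. -/
theorem blocks_of_alternating {p : ℤ → Prop} {n c₁ c₂ c₃ c₄ j₁ j₂ j₃ j₄ : ℤ}
    (h₁ : c₁ < c₂) (h₂ : c₂ < c₃) (h₃ : c₃ < c₄) (h₄ : c₄ < c₁ + n)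
    (hper : ∀ i, p (i + n) ↔ p i)
    (hB₁ : ∀ j, c₁ < j → j ≤ c₂ → ¬ p j) (hB₂ : ∀ j, c₂ < j → j ≤ c₃ → p j)
    (hB₃ : ∀ j, c₃ < j → j ≤ c₄ → ¬ p j) (hB₄ : ∀ j, c₄ < j → j ≤ c₁ + n → p j)
    (hj : c₁ < j₁) (hj' : j₁ ≤ c₁ + n) (k₁ : j₁ < j₂) (k₂ : j₂ < j₃) (k₃ : j₃ < j₄)
    (k₄ : j₄ < j₁ + n) (q₁ : p j₁) (q₂ : ¬ p j₂) (q₃ : p j₃) (q₄ : ¬ p j₄) :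
    (c₃ < j₂ ∧ j₂ ≤ c₄ ∧ c₁ < j₄ - n ∧ j₄ - n ≤ c₂) ∨
      (c₁ < j₂ - n ∧ j₂ - n ≤ c₂ ∧ c₃ < j₄ - n ∧ j₄ - n ≤ c₄) := by
  have hpos : ∀ j, c₁ < j → j ≤ c₁ + n → p j → (c₂ < j ∧ j ≤ c₃) ∨ (c₄ < j ∧ j ≤ c₁ + n) := by
    intro j ha hb hp
    have a : ¬ (c₁ < j ∧ j ≤ c₂) := fun h => hB₁ j h.1 h.2 hp
    have b : ¬ (c₃ < j ∧ j ≤ c₄) := fun h => hB₃ j h.1 h.2 hp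
    omega
  have hneg : ∀ j, c₁ < j → j ≤ c₁ + n → ¬ p j → (c₁ < j ∧ j ≤ c₂) ∨ (c₃ < j ∧ j ≤ c₄) := by
    intro j ha hb hp
    have a : ¬ (c₂ < j ∧ j ≤ c₃) := fun h => hp (hB₂ j h.1 h.2)
    have b : ¬ (c₄ < j ∧ j ≤ c₁ + n) := fun h => hp (hB₄ j h.1 h.2)
    omega
  have hsub : ∀ j, p (j - n) ↔ p j := fun j => by rw [← hper (j - n), sub_add_cancel]
  have a₁ := hpos j₁ hj hj' q₁
  have a₂ : j₂ ≤ c₁ + n ∨ c₁ < j₂ - n := by omega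
  have a₃ : j₃ ≤ c₁ + n ∨ c₁ < j₃ - n := by omega
  have a₄ : j₄ ≤ c₁ + n ∨ c₁ < j₄ - n := by omega
  have b₂ := a₂.imp (fun h => hneg j₂ (by omega) h q₂)
    (fun h => hneg (j₂ - n) h (by omega) ((hsub _).not.2 q₂))
  have b₃ := a₃.imp (fun h => hpos j₃ (by omega) h q₃)
    (fun h => hpos (j₃ - n) h (by omega) ((hsub _).2 q₃))
  have b₄ := a₄.imp (fun h => hneg j₄ (by omega) h q₄)
    (fun h => hneg (j₄ - n) h (by omega) ((hsub _).not.2 q₄))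
  clear hpos hneg hsub hB₁ hB₂ hB₃ hB₄
  omega

theorem exists_parametrization (C : U.EulerSystem) {c : U.Component}
    (hc : C.circuit c ≠ Cycle.nil) :
    ∃ n g, 0 < n ∧ (C.circuit c).IsParam (fun e f => U.head e = U.tail f) n g :=
  Cycle.exists_isParam (C.chain c) (C.nodup c) hc

/-- If at most four edges connect `S` with its complement, then the interlacements between
vertices of `S` and vertices of its complement form a complete bipartite graph. -/
theorem Interlaced.of_cut {C : U.EulerSystem} {S : Set U.V}
    (hS : {e : U.E | ¬ (U.tail e ∈ S ↔ U.head e ∈ S)}.encard ≤ 4) {v v' w w' : U.V}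
    (hv : v ∈ S) (hv' : v' ∈ S) (hw : w ∉ S) (hw' : w' ∉ S)
    (h : C.Interlaced v w) (h' : C.Interlaced v' w') : C.Interlaced v w' := by
  obtain ⟨c, hc, hpos⟩ := h.exists_positions
  obtain ⟨c', hc', hpos'⟩ := h'.exists_positions
  obtain ⟨n, g, hn, hg⟩ := C.exists_parametrization hc
  obtain ⟨i₁, i₂, i₃, i₄, h12, h23, h34, h41, hi1, hi2, hi3, hi4⟩ := hpos _ _ _ hg
  set p : ℤ → Prop := fun i => U.tail (g i) ∈ S with hp
  have hp1 : p i₁ := by simp [hp, hi1, hv]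
  have hp2 : ¬ p i₂ := by simp [hp, hi2, hw]
  have hp3 : p i₃ := by simp [hp, hi3, hv]
  have hp4 : ¬ p i₄ := by simp [hp, hi4, hw]
  have hper : ∀ i m : ℤ, p (i + m * n) ↔ p i := fun i m => by
    simp only [hp, hg.periodic_mul]
  have hp5 : p (i₁ + n) := by simpa using (hper i₁ 1).2 hp1
  -- Between consecutive visits on different sides the circuit traverses a cut edge; this gives four
  -- of them in one period.
  obtain ⟨c₁, h1, h1', hc1⟩ := exists_change h12 (p := p) (by tauto)
  obtain ⟨c₂, h2, h2', hc2⟩ := exists_change h23 (p := p) (by tauto)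
  obtain ⟨c₃, h3, h3', hc3⟩ := exists_change h34 (p := p) (by tauto)
  obtain ⟨c₄, h4, h4', hc4⟩ := exists_change h41 (p := p) (by tauto)
  have hmix : ∀ i, g i ∈ {e : U.E | ¬ (U.tail e ∈ S ↔ U.head e ∈ S)} ↔ ¬ (p i ↔ p (i + 1)) := by
    intro i
    simp only [Set.mem_ofPred_eq, hp, hg.rel i]
  have hne : ∀ {i j : ℤ}, i < j → j < i + n → g i ≠ g j := fun {i j} h₁ h₂ h₃ =>
    h₁.ne (hg.inj i j h₁.le h₂ h₃)
  -- Four distinct cut edges exhaust a cut of size at most four.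
  have hall : {e : U.E | ¬ (U.tail e ∈ S ↔ U.head e ∈ S)} = {g c₁, g c₂, g c₃, g c₄} := by
    have hcard : ({g c₁, g c₂, g c₃, g c₄} : Set U.E).encard = 4 := by
      rw [Set.encard_insert_of_notMem, Set.encard_insert_of_notMem, Set.encard_insert_of_notMem,
        Set.encard_singleton]
      · norm_num
      · simpa using hne (by omega) (by omega)
      · simpa using ⟨hne (by omega) (by omega), hne (by omega) (by omega)⟩
      · simpa using ⟨hne (by omega) (by omega), hne (by omega) (by omega),
          hne (by omega) (by omega)⟩
    refine (Set.Finite.eq_of_subset_of_encard_le (Set.toFinite _) ?_ (hS.trans hcard.ge)).symm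
    rintro e (rfl | rfl | rfl | rfl)
    exacts [(hmix _).2 hc1, (hmix _).2 hc2, (hmix _).2 hc3, (hmix _).2 hc4]
  -- The circuit through `v'` and `w'` also needs a cut edge, and all of these lie on the first
  -- circuit.
  obtain rfl : c = c' := by
    obtain ⟨n', g', -, hg'⟩ := C.exists_parametrization hc'
    obtain ⟨j₁, j₂, -, -, k12, -, -, -, hj1, hj2, -, -⟩ := hpos' _ _ _ hg'
    obtain ⟨d, -, -, hd⟩ := exists_change k12 (p := fun i => U.tail (g' i) ∈ S)
      (by simp [hj1, hj2, hv', hw'])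
    have hd' : g' d ∈ {e : U.E | ¬ (U.tail e ∈ S ↔ U.head e ∈ S)} := by
      simpa only [Set.mem_ofPred_eq, hg'.rel d] using hd
    have : ∃ i, g i = g' d := by
      rw [hall] at hd'
      rcases hd' with hd' | hd' | hd' | hd' <;> exact ⟨_, hd'.symm⟩
    obtain ⟨i, hi⟩ := this
    rw [← (C.mem_iff c _).1 (hg.mem i), hi, (C.mem_iff c' _).1 (hg'.mem d)]
  obtain ⟨j₁, j₂, j₃, j₄, k12, k23, k34, k41, hj1, hj2, hj3, hj4⟩ := hpos' _ _ _ hg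
  have hcut : ∀ i, c₁ < i → i < c₁ + n → ¬ (p i ↔ p (i + 1)) → i = c₂ ∨ i = c₃ ∨ i = c₄ := by
    intro i hi₁ hi₂ hi
    have := (hmix i).2 hi
    rw [hall] at this
    rcases this with h | h | h | h
    · exact absurd h.symm (hne hi₁ hi₂)
    · exact Or.inl (hg.eq_of_abs_lt (by omega) (by omega) h)
    · exact Or.inr (Or.inl (hg.eq_of_abs_lt (by omega) (by omega) h))
    · exact Or.inr (Or.inr (hg.eq_of_abs_lt (by omega) (by omega) h))
  have hconst : ∀ {a b i j : ℤ}, (∀ k, a < k → k < b → (p k ↔ p (k + 1))) → a < i → i ≤ b →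
      a < j → j ≤ b → (p i ↔ p j) := by
    intro a b i j hk ha hb ha' hb'
    by_contra hij
    rcases lt_trichotomy i j with hlt | rfl | hlt
    · obtain ⟨k, h₁, h₂, h₃⟩ := exists_change hlt hij
      exact h₃ (hk k (by omega) (by omega))
    · exact hij Iff.rfl
    · obtain ⟨k, h₁, h₂, h₃⟩ := exists_change hlt (p := p) (by tauto)
      exact h₃ (hk k (by omega) (by omega))
  have hcut' : ∀ {a b : ℤ}, c₁ ≤ a → b ≤ c₁ + n → (∀ k, a < k → k < b → k ≠ c₂ ∧ k ≠ c₃ ∧ k ≠ c₄) →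
      ∀ k, a < k → k < b → (p k ↔ p (k + 1)) := by
    intro a b ha hb hk k hk₁ hk₂
    by_contra hcon
    obtain ⟨n₂, n₃, n₄⟩ := hk k hk₁ hk₂
    rcases hcut k (ha.trans_lt hk₁) (hk₂.trans_le hb) hcon with h | h | h
    exacts [n₂ h, n₃ h, n₄ h]
  -- The side is constant between cuts; `i₂`, `i₃`, `i₄` and `i₁ + n` witness which side each of the
  -- four blocks lies on.
  have hB1 : ∀ j, c₁ < j → j ≤ c₂ → ¬ p j := fun j h₁ h₂ => by
    rwa [hconst (hcut' le_rfl (by omega) (by omega)) h₁ h₂ (show c₁ < i₂ by omega) (by omega)]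
  have hB2 : ∀ j, c₂ < j → j ≤ c₃ → p j := fun j h₁ h₂ => by
    rwa [hconst (hcut' (a := c₂) (b := c₃) (by omega) (by omega) (by omega)) h₁ h₂
      (show c₂ < i₃ by omega) (by omega)]
  have hB3 : ∀ j, c₃ < j → j ≤ c₄ → ¬ p j := fun j h₁ h₂ => by
    rwa [hconst (hcut' (a := c₃) (b := c₄) (by omega) (by omega) (by omega)) h₁ h₂
      (show c₃ < i₄ by omega) (by omega)]
  have hB4 : ∀ j, c₄ < j → j ≤ c₁ + n → p j := fun j h₁ h₂ => by
    rwa [hconst (hcut' (a := c₄) (b := c₁ + n) (by omega) (by omega) (by omega)) h₁ h₂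
      (show c₄ < i₁ + n by omega) (by omega)]
  have hn0 : (0 : ℤ) < n := by exact_mod_cast hn
  -- The second quadruple is translated by a multiple of the period so that it starts in the window
  -- of the four blocks.
  obtain ⟨t, ⟨ht₁, ht₂⟩, -⟩ := existsUnique_add_zsmul_mem_Ioc hn0 j₁ c₁
  rw [smul_eq_mul] at ht₁ ht₂
  set s := t * (n : ℤ) with hs
  have q1 : p (j₁ + s) := (hper j₁ t).2 (by simp [hp, hj1, hv'])
  have q2 : ¬ p (j₂ + s) := fun hq => hw' (by simpa [hp, hj2] using (hper j₂ t).1 hq)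
  have q3 : p (j₃ + s) := (hper j₃ t).2 (by simp [hp, hj3, hv'])
  have q4 : ¬ p (j₄ + s) := fun hq => hw' (by simpa [hp, hj4] using (hper j₄ t).1 hq)
  have ht2 : U.tail (g (j₂ + s)) = w' := by rw [hs, hg.periodic_mul, hj2]
  have ht4 : U.tail (g (j₄ + s)) = w' := by rw [hs, hg.periodic_mul, hj4]
  have ht4' : U.tail (g (j₄ + s - n)) = w' := by
    rw [← ht4, ← hg.periodic (j₄ + s - n), sub_add_cancel]
  have ht2' : U.tail (g (j₂ + s - n)) = w' := by
    rw [← ht2, ← hg.periodic (j₂ + s - n), sub_add_cancel]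
  have hvn : U.tail (g (i₁ + n)) = v := by rw [hg.periodic, hi1]
  have hne' : w' ≠ v := fun h => hw' (h ▸ hv)
  -- Now `w'` occurs in the first and third blocks, and `v` at `i₃` in the second and at `i₁ + n` in
  -- the fourth, so they alternate starting with `w'`.
  refine Interlaced.symm ?_
  rcases blocks_of_alternating (p := p) (by omega) (by omega) (by omega) (by omega)
    (fun i => by simpa using hper i 1) hB1 hB2 hB3 hB4 ht₁ ht₂ (by omega) (by omega) (by omega)
    (show j₄ + s < j₁ + s + n by omega) q1 q2 q3 q4 with ⟨e1, e2, e3, e4⟩ | ⟨e1, e2, e3, e4⟩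
  · exact interlaced_of_positions hne' hg (i := j₄ + s - n) (j := i₃) (k := j₂ + s) (m := i₁ + n)
      (by omega) (by omega) (by omega) (by omega) ht4' hi3 ht2 hvn
  · exact interlaced_of_positions hne' hg (i := j₂ + s - n) (j := i₃) (k := j₄ + s - n)
      (m := i₁ + n) (by omega) (by omega) (by omega) (by omega) ht2' hi3 ht4' hvn

end EulerSystem
end FLDigraph

namespace FLDigraph

open Equiv Equiv.Perm Function

variable {U : FLDigraph}

/-! ### Euler systems with pairwise non-interlaced transitions -/

/-- A permutation `φ` of the edges that continues each edge by an edge, that agrees with `φ₀`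
at the vertices not in `M`, and whose cycles traverse each vertex of `M` in such a way that no two
vertices of `M` are interlaced. -/
structure IsForestTransition [DecidableEq U.E] (φ₀ φ : Perm U.E) (M : Set U.V) : Prop where
  head_eq : ∀ e, U.head e = U.tail (φ e)
  eq_of_notMem : ∀ e, U.tail (φ e) ∉ M → φ e = φ₀ e
  sameCycle : ∀ e e', U.tail e ∈ M → U.tail e = U.tail e' → φ.SameCycle e e'
  sameCycle_swap : ∀ e e' f f', U.tail e ∈ M → U.tail e = U.tail e' → e ≠ e' → U.tail f ∈ M →
    U.tail f = U.tail f' → U.tail e ≠ U.tail f → (swap e e' * φ).SameCycle f f'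

/-- Undoing the new merge gives back `φ`. Undoing an older one commutes with the new merge, because
the two transpositions are disjoint; it only refines the cycles of `φ`, so the new transposition
still merges two distinct cycles and separates nothing. -/
theorem IsForestTransition.swap_mul [DecidableEq U.E] [Finite U.E]
    (h2 : ∀ x y z : U.E, U.tail x = U.tail y → U.tail y = U.tail z → x = y ∨ y = z ∨ x = z)
    {φ₀ φ : Perm U.E} {M : Set U.V} (h : IsForestTransition φ₀ φ M) {g g' : U.E}
    (hg : U.tail g = U.tail g') (hc : ¬ φ.SameCycle g g') :
    IsForestTransition φ₀ (swap g g' * φ) (insert (U.tail g) M) := by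
  have hne : g ≠ g' := fun h => hc (h ▸ SameCycle.refl φ g)
  have hu : U.tail g ∉ M := fun hM => hc (h.sameCycle g g' hM hg)
  have htail : ∀ x, U.tail (swap g g' x) = U.tail x := by
    intro x
    rw [swap_apply_def]
    split_ifs with h₁ h₂
    · rw [h₁, hg]
    · rw [h₂, hg]
    · rfl
  have hpair : ∀ e e', U.tail g = U.tail e → U.tail e = U.tail e' → e ≠ e' →
      (e = g ∧ e' = g') ∨ (e = g' ∧ e' = g) := by
    intro e e' h₁ h₂ h₃
    have a := h2 g g' e hg (hg.symm.trans h₁)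
    have b := h2 g g' e' hg (hg.symm.trans (h₁.trans h₂))
    rcases a with a | a | a
    · exact absurd a hne
    · rcases b with b | b | b
      · exact absurd b hne
      · exact absurd (a.symm.trans b) h₃
      · exact Or.inr ⟨a.symm, b.symm⟩
    · rcases b with b | b | b
      · exact absurd b hne
      · exact Or.inl ⟨a.symm, b.symm⟩
      · exact absurd (a.symm.trans b) h₃
  refine ⟨?_, ?_, ?_, ?_⟩
  · intro e
    rw [Perm.mul_apply, htail, h.head_eq]
  · intro e he
    rw [Perm.mul_apply, htail, Set.mem_insert_iff, not_or] at he
    have h₁ : φ e ≠ g := fun h' => he.1 (by rw [h'])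
    have h₂ : φ e ≠ g' := fun h' => he.1 (by rw [h', hg])
    rw [Perm.mul_apply, swap_apply_of_ne_of_ne h₁ h₂, h.eq_of_notMem e he.2]
  · intro e e' he hee
    rcases he with he | he
    · by_cases hx : e = e'
      · rw [hx]
      · rcases hpair e e' he.symm hee hx with ⟨rfl, rfl⟩ | ⟨rfl, rfl⟩
        · exact sameCycle_swap_mul_self hc
        · exact (sameCycle_swap_mul_self hc).symm
    · exact (h.sameCycle e e' he hee).swap_mul hc
  · intro e e' f f' he hee hne' hf hff hef
    rcases he with he | he
    · have hfM : U.tail f ∈ M := hf.resolve_left fun hf => hef (he.trans hf.symm)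
      have : swap e e' * (swap g g' * φ) = φ := by
        rcases hpair e e' he.symm hee hne' with ⟨rfl, rfl⟩ | ⟨rfl, rfl⟩
        · rw [swap_mul_self_mul]
        · rw [swap_comm, swap_mul_self_mul]
      rw [this]
      exact h.sameCycle f f' hfM hff
    · have hdisj : swap e e' * (swap g g' * φ) = swap g g' * (swap e e' * φ) := by
        have h₁ : ∀ {x y}, U.tail x ∈ M → U.tail y = U.tail g → x ≠ y := by
          rintro x y hx hy rfl
          exact hu (hy ▸ hx)
        have he' : U.tail e' ∈ M := hee ▸ he
        rw [← mul_assoc, ← mul_assoc]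
        congr 1
        refine (Perm.disjoint_swap_swap ?_).commute
        simp [hne, hne', h₁ he rfl, h₁ he hg.symm, h₁ he' rfl, h₁ he' hg.symm]
      have hc' : ¬ (swap e e' * φ).SameCycle g g' := fun hx =>
        hc (SameCycle.of_swap_mul (h.sameCycle e e' he hee) hx)
      rw [hdisj]
      rcases hf with hf | hf
      · by_cases hx : f = f'
        · rw [hx]
        · rcases hpair f f' hf.symm hff hx with ⟨rfl, rfl⟩ | ⟨rfl, rfl⟩
          · exact sameCycle_swap_mul_self hc'
          · exact (sameCycle_swap_mul_self hc').symm
      · exact (h.sameCycle_swap e e' f f' he hee hne' hf hff hef).swap_mul hc'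

/-- Among the finitely many forest transitions, take one with the most pairs of edges in a common
cycle; any further merge would increase that number. -/
theorem exists_isForestTransition [DecidableEq U.E] [Finite U.E]
    (h2 : ∀ x y z : U.E, U.tail x = U.tail y → U.tail y = U.tail z → x = y ∨ y = z ∨ x = z)
    {φ₀ : Perm U.E} (h₀ : ∀ e, U.head e = U.tail (φ₀ e)) :
    ∃ φ M, IsForestTransition φ₀ φ M ∧ ∀ e e', U.tail e = U.tail e' → φ.SameCycle e e' := by
  let A : Set (Perm U.E) := {φ | ∃ M, IsForestTransition φ₀ φ M}
  have hA : A.Nonempty := ⟨φ₀, ∅, h₀, fun _ _ => rfl, fun _ _ h => h.elim,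
    fun _ _ _ _ h => h.elim⟩
  obtain ⟨φ, ⟨M, hφ⟩, hmax⟩ := Set.exists_max_image A
    (fun φ => {x : U.E × U.E | φ.SameCycle x.1 x.2}.ncard) (Set.toFinite A) hA
  refine ⟨φ, M, hφ, fun g g' hg => ?_⟩
  by_contra hc
  have h₁ := hmax _ ⟨_, hφ.swap_mul h2 hg hc⟩
  refine h₁.not_gt (Set.ncard_lt_ncard ?_ (Set.toFinite _))
  refine Set.ssubset_iff_exists.2 ⟨fun x hx => SameCycle.swap_mul hc hx, (g, g'),
    sameCycle_swap_mul_self hc, hc⟩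

/-- The Euler system whose circuits are the cycles of a permutation of the edges. -/
theorem exists_eulerSystem_of_perm [Finite U.E] {φ : Perm U.E}
    (h : ∀ e, U.head e = U.tail (φ e)) (hs : Surjective U.tail)
    (hc : ∀ e e', U.tail e = U.tail e' → φ.SameCycle e e') :
    ∃ C : U.EulerSystem, ∀ c, (C.circuit c).Chain fun e f => f = φ e := by
  -- The cycle of the edges leaving a vertex is the same at both ends of an edge, so it depends only
  -- on the component. This map shows that a component carries a single cycle.
  let F : U.Component → Quotient (SameCycle.setoid φ) :=
    Quot.lift (fun x => Quotient.mk _ (surjInv hs x)) (by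
      rintro x y ⟨e, rfl, rfl⟩
      refine Quotient.sound (s := SameCycle.setoid φ) ?_
      have h₁ : φ.SameCycle (surjInv hs (U.tail e)) e := hc _ _ (surjInv_eq hs _)
      have h₂ : φ.SameCycle (φ e) (surjInv hs (U.head e)) :=
        hc _ _ ((h e).symm.trans (surjInv_eq hs _).symm)
      exact h₁.trans ((sameCycle_apply_right.2 (SameCycle.refl φ e)).trans h₂))
  have hF : ∀ e, F (U.component (U.tail e)) = Quotient.mk _ e := fun e =>
    Quotient.sound (s := SameCycle.setoid φ) (hc _ _ (surjInv_eq hs _))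
  have hcomp : ∀ e f, φ.SameCycle e f ↔ U.component (U.tail e) = U.component (U.tail f) := by
    intro e f
    constructor
    · refine SameCycle.of_forall_apply (r := fun e f => U.component (U.tail e) =
        U.component (U.tail f)) ⟨fun _ => rfl, Eq.symm, Eq.trans⟩ fun x => ?_
      rw [← h]
      exact Quot.sound ⟨x, rfl, rfl⟩
    · intro hef
      have := congrArg F hef
      rw [hF, hF] at this
      exact Quotient.exact this
  have hsc : ∀ c, ∃ e, U.component (U.tail e) = c := by
    intro c
    obtain ⟨x, rfl⟩ := Quot.exists_rep c
    obtain ⟨e, rfl⟩ := hs x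
    exact ⟨e, rfl⟩
  choose b hb using hsc
  have hper : ∀ e, e ∈ periodicPts φ := fun e =>
    ⟨orderOf φ, orderOf_pos φ, by
      rw [IsPeriodicPt, ← Perm.coe_pow, pow_orderOf_eq_one]; exact rfl⟩
  refine ⟨⟨fun c => periodicOrbit φ (b c), ?_, fun c => nodup_periodicOrbit, ?_⟩, ?_⟩
  · intro c
    rw [periodicOrbit_chain]
    intro n _
    rw [h, iterate_succ_apply']
  · intro c e
    rw [mem_periodicOrbit_iff (hper _), ← hb c, eq_comm, ← hcomp, hb]
    constructor
    · rintro ⟨n, rfl⟩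
      exact ⟨n, by rw [zpow_natCast, Perm.coe_pow]⟩
    · intro hce
      obtain ⟨n, hn⟩ := hce.exists_nat_pow_eq
      exact ⟨n, by rw [← hn, Perm.coe_pow]⟩
  · intro c
    rw [periodicOrbit_chain]
    intro n _
    rw [iterate_succ_apply']

/-- Undoing the transition at `x` cuts the circuit at the two visits to `x`. If `y` were interlaced
with `x`, its two visits would land in different pieces, against `sameCycle_swap`. -/
theorem IsForestTransition.not_interlaced [DecidableEq U.E] [Finite U.E] {φ₀ φ : Perm U.E}
    {M : Set U.V} (h : IsForestTransition φ₀ φ M) {C : U.EulerSystem}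
    (hC : ∀ c, (C.circuit c).Chain fun e f => f = φ e) {x y : U.V} (hx : x ∈ M) (hy : y ∈ M) :
    ¬ C.Interlaced x y := by
  intro hxy
  obtain ⟨c, hc, hpos⟩ := hxy.exists_positions
  obtain ⟨n, g, -, hg⟩ := Cycle.exists_isParam (hC c) (C.nodup c) hc
  obtain ⟨i, j, k, m, hij, hjk, hkm, hmi, hi, hj, hk, hm⟩ := hpos _ _ _ hg
  have hne : g i ≠ g k := fun h => by
    have := hg.inj i k (by omega) (by omega) h
    omega
  have hsc := h.sameCycle_swap (g i) (g k) (g j) (g m) (hi ▸ hx) (hi.trans hk.symm) hne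
    (hj ▸ hy) (hj.trans hm.symm) (by rw [hi, hj]; exact hxy.1)
  -- The segment from `i` to `k - 1` is closed under the modified permutation, whose value at `g (k
  -- - 1)` is `g i`; it contains `g j` but not `g m`.
  have hmem := hsc.mem_of_forall_apply_mem (S := {z | ∃ a, i ≤ a ∧ a < k ∧ g a = z}) ?_
    ⟨j, hij.le, hjk, rfl⟩
  · obtain ⟨a, ha₁, ha₂, ha⟩ := hmem
    have := hg.inj a m (by omega) (by omega) ha
    omega
  · rintro _ ⟨a, ha₁, ha₂, rfl⟩
    rw [Perm.mul_apply, ← hg.rel a]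
    by_cases hak : a + 1 = k
    · rw [hak, swap_apply_right]
      exact ⟨i, le_rfl, by omega, rfl⟩
    · rw [swap_apply_of_ne_of_ne]
      · exact ⟨a + 1, by omega, by omega, rfl⟩
      · intro h'
        have := hg.inj i (a + 1) (by omega) (by omega) h'.symm
        omega
      · intro h'
        have := hg.inj (a + 1) k (by omega) (by omega) h'
        omega

/-- A directed graph with at most two outgoing edges at each vertex, with a decomposition into
closed walks given by a permutation `φ₀` of the edges, has a directed Euler system that follows
these walks except at some vertices, no two of which are interlaced. -/
theorem exists_eulerSystem_not_interlaced [Finite U.E] {φ₀ : Perm U.E}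
    (h₀ : ∀ e, U.head e = U.tail (φ₀ e)) (hs : Surjective U.tail)
    (h2 : ∀ x y z : U.E, U.tail x = U.tail y → U.tail y = U.tail z → x = y ∨ y = z ∨ x = z) :
    ∃ (C : U.EulerSystem) (M : Set U.V),
      (∀ e f, C.Follows e f → U.head e ∉ M → f = φ₀ e) ∧
      ∀ x ∈ M, ∀ y ∈ M, ¬ C.Interlaced x y := by
  classical
  obtain ⟨φ, M, hφ, hc⟩ := exists_isForestTransition h2 h₀
  obtain ⟨C, hC⟩ := exists_eulerSystem_of_perm hφ.head_eq hs hc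
  refine ⟨C, M, fun e f hef he => ?_, fun x hx y hy => hφ.not_interlaced hC hx hy⟩
  obtain rfl := hef.of_chain hC
  exact hφ.eq_of_notMem e (by rwa [← hφ.head_eq])

end FLDigraph

namespace LinkDiagram

open FLDigraph

variable {D : LinkDiagram}

/-! ### Arcs between classical crossings -/

/-- The passage reached from `p` after time `r`. -/
def advance (p : D.Passage) (r : ℝ) : D.Passage := (p.1, p.2 + (r : UnitAddCircle))

theorem advance_zero (p : D.Passage) : advance p 0 = p := by simp [advance]

theorem advance_one (p : D.Passage) : advance p 1 = p := by
  have : ((1 : ℝ) : UnitAddCircle) = 0 := AddCircle.coe_period 1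
  simp [advance, this]

theorem advance_advance (p : D.Passage) (r s : ℝ) :
    advance (advance p r) s = advance p (r + s) := by
  simp [advance, add_assoc]

theorem continuous_pt_advance (p : D.Passage) : Continuous fun r => D.pt (advance p r) :=
  (D.continuous_curve p.1).comp (continuous_const.add (AddCircle.continuous_mk' 1))

theorem isArc_iff {p q : D.Passage} : D.IsArc p q ↔ D.pt p ∈ D.classical ∧ D.pt q ∈ D.classical ∧
    ∃ s : ℝ, 0 < s ∧ s ≤ 1 ∧ q = advance p s ∧
      ∀ r : ℝ, 0 < r → r < s → D.pt (advance p r) ∉ D.classical := by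
  simp only [IsArc, advance, Prod.ext_iff]
  constructor
  · rintro ⟨h₁, h₂, h₃, s, h₄, h₅, h₆, h₇⟩
    exact ⟨h₁, h₂, s, h₄, h₅, ⟨h₃, h₆⟩, h₇⟩
  · rintro ⟨h₁, h₂, s, h₄, h₅, ⟨h₃, h₆⟩, h₇⟩
    exact ⟨h₁, h₂, h₃, s, h₄, h₅, h₆, h₇⟩

theorem finite_classical_passages (D : LinkDiagram) : {p | D.pt p ∈ D.classical}.Finite := by
  refine (D.finite_crossings.subset D.classical_subset).preimage' (f := D.pt) fun x hx => ?_
  obtain ⟨p, q, hpq, hp, hq⟩ := D.classical_subset hx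
  refine (Set.toFinite {p, q}).subset fun r hr => ?_
  rcases D.double p q r (hp.trans hq.symm) (hq.trans (Eq.symm hr)) with h | h | h
  · exact absurd h hpq
  · exact Or.inr h.symm
  · exact Or.inl h.symm

theorem exists_isArc {p : D.Passage} (hp : D.pt p ∈ D.classical) : ∃ q, D.IsArc p q := by
  set A : Set ℝ := {r | r ∈ Set.Ioc (0 : ℝ) 1 ∧ D.pt (advance p r) ∈ D.classical} with hA
  have hinj : Set.InjOn (advance p) (Set.Ioc 0 1) := by
    intro r hr s hs h
    have h' : ((r : ℝ) : UnitAddCircle) = s := add_left_cancel (Prod.ext_iff.1 h).2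
    have hr' : r ∈ Set.Ioc (0 : ℝ) (0 + 1) := by simpa using hr
    have hs' : s ∈ Set.Ioc (0 : ℝ) (0 + 1) := by simpa using hs
    exact (AddCircle.coe_eq_coe_iff_of_mem_Ioc hr' hs').1 h'
  have hfin : A.Finite :=
    Set.Finite.of_finite_image ((D.finite_classical_passages).subset (by
      rintro _ ⟨r, hr, rfl⟩
      exact hr.2)) (hinj.mono fun r hr => hr.1)
  -- After time `1` the curve is back at `p`, which is the next classical passage if there is no
  -- earlier one.
  have hne : A.Nonempty := ⟨1, ⟨one_pos, le_rfl⟩, by rwa [advance_one]⟩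
  obtain ⟨s, hs, hmin⟩ := Set.exists_min_image A id hfin hne
  refine ⟨advance p s, isArc_iff.2 ⟨hp, hs.2, s, hs.1.1, hs.1.2, rfl, fun r h₁ h₂ h₃ => ?_⟩⟩
  exact h₂.not_ge (hmin r ⟨⟨h₁, h₂.le.trans hs.1.2⟩, h₃⟩)

theorem IsArc.right_unique {p q q' : D.Passage} (h : D.IsArc p q) (h' : D.IsArc p q') :
    q = q' := by
  obtain ⟨-, hq, s, hs, -, rfl, hr⟩ := isArc_iff.1 h
  obtain ⟨-, hq', s', hs', -, rfl, hr'⟩ := isArc_iff.1 h'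
  rcases lt_trichotomy s s' with hlt | rfl | hlt
  · exact absurd hq (hr' s hs hlt)
  · rfl
  · exact absurd hq' (hr s' hs' hlt)

/-- Going backwards from a passage, the first classical passage is unique. The common passage need
not be classical, so this applies to ends of arcs and to their boundary points alike. -/
theorem eq_of_advance_eq_advance {p p' : D.Passage} (hp : D.pt p ∈ D.classical)
    (hp' : D.pt p' ∈ D.classical) {r r' : ℝ} (hr : 0 < r) (hr' : 0 < r')
    (h : ∀ t, 0 < t → t < r → D.pt (advance p t) ∉ D.classical)
    (h' : ∀ t, 0 < t → t < r' → D.pt (advance p' t) ∉ D.classical)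
    (heq : advance p r = advance p' r') : p = p' := by
  wlog hle : r ≤ r' generalizing p p' r r'
  · exact (this hp' hp hr' hr h' h heq.symm (not_le.1 hle).le).symm
  have hpp : p = advance p' (r' - r) := by
    have := congrArg (advance · (-r)) heq
    simpa only [advance_advance, add_neg_cancel, advance_zero, ← sub_eq_add_neg] using this
  rcases hle.eq_or_lt with rfl | hlt
  · rwa [sub_self, advance_zero] at hpp
  · rw [hpp] at hp
    exact absurd hp (h' _ (sub_pos.2 hlt) (by linarith))

theorem IsArc.left_unique {p p' q : D.Passage} (h : D.IsArc p q) (h' : D.IsArc p' q) :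
    p = p' := by
  obtain ⟨hp, hq, s, hs, -, rfl, hr⟩ := isArc_iff.1 h
  obtain ⟨hp', hq', s', hs', -, heq, hr'⟩ := isArc_iff.1 h'
  exact eq_of_advance_eq_advance hp hp' hs hs' hr hr' heq

theorem edge_ext {e f : D.directedUniverse.E} (h : e.1.1 = f.1.1) : e = f :=
  Subtype.ext (Prod.ext h (e.2.right_unique (h ▸ f.2)))

instance : Finite D.directedUniverse.E := by
  have := (D.finite_classical_passages).to_subtype
  refine Finite.of_injective
    (fun e : D.directedUniverse.E => (⟨e.1.1, e.2.1⟩ : {p | D.pt p ∈ D.classical})) ?_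
  intro e f h
  exact edge_ext (Subtype.ext_iff.1 h)

theorem tail_surjective : Function.Surjective D.directedUniverse.tail := by
  rintro ⟨x, hx⟩
  obtain ⟨p, -, -, rfl, -⟩ := D.classical_subset hx
  obtain ⟨q, hq⟩ := exists_isArc hx
  exact ⟨⟨(p, q), hq⟩, rfl⟩

theorem tail_double (e f g : D.directedUniverse.E)
    (hef : D.directedUniverse.tail e = D.directedUniverse.tail f)
    (hfg : D.directedUniverse.tail f = D.directedUniverse.tail g) : e = f ∨ f = g ∨ e = g :=
  (D.double e.1.1 f.1.1 g.1.1 (Subtype.ext_iff.1 hef) (Subtype.ext_iff.1 hfg)).imp edge_ext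
    (Or.imp edge_ext edge_ext)

/-- The permutation of the arcs that follows the link components. -/
theorem exists_linkPerm (D : LinkDiagram) :
    ∃ φ : Equiv.Perm D.directedUniverse.E, ∀ e, (φ e).1.1 = e.1.2 := by
  have h : ∀ e : D.directedUniverse.E, ∃ f : D.directedUniverse.E, f.1.1 = e.1.2 := fun e => by
    obtain ⟨q, hq⟩ := exists_isArc e.2.2.1
    exact ⟨⟨(e.1.2, q), hq⟩, rfl⟩
  choose f hf using h
  have hinj : Function.Injective f := fun e e' hee => by
    have h₂ : e.1.2 = e'.1.2 := by rw [← hf e, ← hf e', hee]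
    exact edge_ext (e.2.left_unique (h₂ ▸ e'.2))
  exact ⟨Equiv.ofBijective f (Finite.injective_iff_bijective.1 hinj), hf⟩

/-- Some directed Euler system has no two interlaced marked vertices. -/
theorem exists_eulerSystem_marked_not_interlaced (D : LinkDiagram) :
    ∃ C : D.EulerSystem, ∀ x y, x.1 ∈ D.markedCrossings C → y.1 ∈ D.markedCrossings C →
      ¬ C.Interlaced x y := by
  obtain ⟨φ, hφ⟩ := D.exists_linkPerm
  obtain ⟨C, M, hM, hC⟩ := exists_eulerSystem_not_interlaced (φ₀ := φ)
    (fun e => Subtype.ext (congrArg D.pt (hφ e).symm)) tail_surjective tail_double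
  have hmark : ∀ x : D.directedUniverse.V, x.1 ∈ D.markedCrossings C → x ∈ M := by
    rintro x ⟨e, f, hef, hx, hne⟩
    by_contra hxM
    obtain rfl : D.directedUniverse.head e = x := Subtype.ext hx
    exact hne (by rw [hM e f hef hxM, hφ])
  exact ⟨C, fun x y hx hy => hC x (hmark x hx) y (hmark y hy)⟩

/-! ### The arcs that meet the boundary of a tangle -/

namespace Tangle

variable (T : D.Tangle)

theorem notMem_boundary_of_classical {x : Plane} (hx : x ∈ D.classical) : x ∉ T.boundary :=
  fun h => Set.disjoint_left.1 T.not_crossing h (D.classical_subset hx)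

theorem mem_outside_iff {x : Plane} (hx : x ∈ D.classical) : x ∈ T.outside ↔ x ∉ T.inside := by
  simp [inside, outside, T.notMem_boundary_of_classical hx]

theorem mem_inside_iff_of_connected {x y : Plane} {A : Set Plane} (hA : IsPreconnected A)
    (hAT : A ⊆ T.boundaryᶜ) (hx : x ∈ A) (hy : y ∈ A) : x ∈ T.inside ↔ y ∈ T.inside := by
  have h : connectedComponentIn T.boundaryᶜ x = connectedComponentIn T.boundaryᶜ y :=
    connectedComponentIn_eq (hA.subset_connectedComponentIn hx hAT hy)
  have hx' : x ∉ T.boundary := hAT hx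
  have hy' : y ∉ T.boundary := hAT hy
  simp [inside, h, hx', hy']

/-- An arc that misses the circle is a connected set in its complement. The absence of classical
passages before time `r` keeps the boundary point on the arc itself. -/
theorem exists_advance_mem_boundary {e : D.directedUniverse.E}
    (he : ¬ (D.pt e.1.1 ∈ T.inside ↔ D.pt e.1.2 ∈ T.inside)) :
    ∃ r : ℝ, 0 < r ∧ (∀ t, 0 < t → t < r → D.pt (advance e.1.1 t) ∉ D.classical) ∧
      D.pt (advance e.1.1 r) ∈ T.boundary := by
  obtain ⟨hp, -, s, hs, -, hq, hr⟩ := isArc_iff.1 e.2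
  by_contra! hc
  refine he (T.mem_inside_iff_of_connected
    (A := (fun r => D.pt (advance e.1.1 r)) '' Set.Icc 0 s) ?_ ?_ ?_ ?_)
  · exact isPreconnected_Icc.image _ (continuous_pt_advance _).continuousOn
  · rintro _ ⟨r, ⟨hr₁, hr₂⟩, rfl⟩
    rcases hr₁.eq_or_lt with rfl | hr₁
    · simpa only [advance_zero, Set.mem_compl_iff] using T.notMem_boundary_of_classical hp
    · exact hc r hr₁ fun t ht₁ ht₂ => hr t ht₁ (ht₂.trans_le hr₂)
  · exact ⟨0, ⟨le_rfl, hs.le⟩, by simp only [advance_zero]⟩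
  · exact ⟨s, ⟨hs.le, le_rfl⟩, by simp only [← hq]⟩

theorem eq_of_pt_mem_boundary {p q : D.Passage} (h : D.pt p ∈ T.boundary)
    (hpq : D.pt p = D.pt q) : p = q := by
  by_contra hne
  exact Set.disjoint_left.1 T.not_crossing h ⟨p, q, hne, rfl, hpq.symm⟩

/-- Sending a mixed arc to a boundary point on it is injective: a boundary point is no crossing, so
it determines its passage, and the passage determines the arc. -/
theorem encard_mixed_le : {e : D.directedUniverse.E |
    ¬ (D.directedUniverse.tail e ∈ {x : D.directedUniverse.V | x.1 ∈ T.inside} ↔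
      D.directedUniverse.head e ∈ {x : D.directedUniverse.V | x.1 ∈ T.inside})}.encard ≤ 4 := by
  classical
  rw [← T.four_points]
  have h : ∀ e : D.directedUniverse.E, ∃ r : ℝ,
      ¬ (D.pt e.1.1 ∈ T.inside ↔ D.pt e.1.2 ∈ T.inside) →
      0 < r ∧ (∀ t, 0 < t → t < r → D.pt (advance e.1.1 t) ∉ D.classical) ∧
        D.pt (advance e.1.1 r) ∈ T.boundary := fun e => by
    -- The time `0` for arcs that are not mixed is a dummy value that makes `r` total.
    by_cases he : D.pt e.1.1 ∈ T.inside ↔ D.pt e.1.2 ∈ T.inside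
    · exact ⟨0, fun h => absurd he h⟩
    · obtain ⟨r, hr⟩ := T.exists_advance_mem_boundary he
      exact ⟨r, fun _ => hr⟩
  choose r hr using h
  refine Set.encard_le_encard_of_injOn (f := fun e => D.pt (advance e.1.1 (r e))) ?_ ?_
  · intro e he
    exact ⟨(hr e he).2.2, Set.mem_range_self _⟩
  · intro e he f hf hef
    obtain ⟨he₁, he₂, he₃⟩ := hr e he
    obtain ⟨hf₁, hf₂, -⟩ := hr f hf
    exact edge_ext (eq_of_advance_eq_advance e.2.1 f.2.1 he₁ hf₁ he₂ hf₂
      (T.eq_of_pt_mem_boundary he₃ hef))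

end Tangle

/-! ### Decompositions along a tangle -/

theorem interlacementGraph_adj_of_tangle (T : D.Tangle) (C : D.EulerSystem) {R : Type u}
    (α β : Plane → R) {v v' w w' : Plane} (hv : v ∈ T.inside) (hv' : v' ∈ T.inside)
    (hw : w ∉ T.inside) (hw' : w' ∉ T.inside) (h : (D.interlacementGraph C α β).Adj v w)
    (h' : (D.interlacementGraph C α β).Adj v' w') : (D.interlacementGraph C α β).Adj v w' := by
  obtain ⟨hvc, hwc, h⟩ := h
  obtain ⟨hvc', hwc', h'⟩ := h'
  exact ⟨hvc, hwc', EulerSystem.Interlaced.of_cut T.encard_mixed_le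
    (v := ⟨v, hvc⟩) (v' := ⟨v', hvc'⟩) (w := ⟨w, hwc⟩) (w' := ⟨w', hwc'⟩) hv hv' hw hw' h h'⟩

end LinkDiagram

/-! ### Adjoining an apex to an induced subgraph -/

namespace MarkedGraph

variable {X : Type u} {R : Type v}

open Classical in
/-- The graph obtained from the subgraph of `G` induced by `S`, with `k` free loops, by adjoining
an unlooped, unmarked vertex `a` with weights `A` and `B`, adjacent to the vertices in `N`. -/
noncomputable def coneOver (G : MarkedGraph X R) (S N : Set X) (hN : N ⊆ G.verts ∩ S) (a : X)
    (ha : a ∉ G.verts) (k : ℕ) (A B : R) : MarkedGraph X R where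
  verts := insert a (G.verts ∩ S)
  finite_verts := (G.finite_verts.inter_of_left S).insert a
  Adj x y := (G.Adj x y ∧ x ∈ S ∧ y ∈ S) ∨ (x = a ∧ y ∈ N) ∨ (x ∈ N ∧ y = a)
  adj_symm := by
    rintro x y (⟨h, hx, hy⟩ | ⟨hx, hy⟩ | ⟨hx, hy⟩)
    exacts [Or.inl ⟨G.adj_symm h, hy, hx⟩, Or.inr (Or.inr ⟨hy, hx⟩), Or.inr (Or.inl ⟨hy, hx⟩)]
  adj_irrefl := by
    rintro x (⟨h, -, -⟩ | ⟨rfl, h⟩ | ⟨h, rfl⟩)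
    exacts [G.adj_irrefl x h, ha (hN h).1, ha (hN h).1]
  left_mem := by
    rintro x y (⟨h, hx, -⟩ | ⟨rfl, -⟩ | ⟨h, -⟩)
    exacts [Or.inr ⟨G.left_mem h, hx⟩, Or.inl rfl, Or.inr (hN h)]
  looped := G.looped ∩ S
  looped_subset := fun _ h => Or.inr ⟨G.looped_subset h.1, h.2⟩
  marked := G.marked ∩ S
  marked_subset := fun _ h => Or.inr ⟨G.marked_subset h.1, h.2⟩
  freeLoops := k
  wα := Function.update G.wα a A
  wβ := Function.update G.wβ a B

variable {G : MarkedGraph X R} {S N : Set X} {hN : N ⊆ G.verts ∩ S} {a : X} {ha : a ∉ G.verts}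
  {k : ℕ} {A B : R}

theorem coneOver_verts_sdiff : (G.coneOver S N hN a ha k A B).verts \ {a} = G.verts ∩ S := by
  simp only [coneOver]
  ext x
  simp only [Set.mem_sdiff, Set.mem_insert_iff, Set.mem_singleton_iff, Set.mem_inter_iff]
  constructor
  · tauto
  · rintro ⟨h₁, h₂⟩
    exact ⟨Or.inr ⟨h₁, h₂⟩, fun h => ha (h ▸ h₁)⟩

theorem isStandardVertex_coneOver : (G.coneOver S N hN a ha k A B).IsStandardVertex A B a where
  mem := Or.inl rfl
  not_looped h := ha (G.looped_subset h.1)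
  not_marked h := ha (G.marked_subset h.1)
  wα_eq := by simp [coneOver]
  wβ_eq := by simp [coneOver]

theorem wα_coneOver {x : X} (hx : x ∈ G.verts) :
    (G.coneOver S N hN a ha k A B).wα x = G.wα x := by
  have hxa : x ≠ a := fun h => ha (h ▸ hx)
  simp [coneOver, hxa]

theorem wβ_coneOver {x : X} (hx : x ∈ G.verts) :
    (G.coneOver S N hN a ha k A B).wβ x = G.wβ x := by
  have hxa : x ≠ a := fun h => ha (h ▸ hx)
  simp [coneOver, hxa]

theorem right_mem (G : MarkedGraph X R) {x y : X} (h : G.Adj x y) : y ∈ G.verts :=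
  G.left_mem (G.adj_symm h)

theorem coneOver_adj_apex {x : X} : (G.coneOver S N hN a ha k A B).Adj x a ↔ x ∈ N := by
  constructor
  · rintro (⟨h, -, -⟩ | ⟨-, h⟩ | ⟨h, -⟩)
    exacts [absurd (G.right_mem h) ha, absurd (hN h).1 ha, h]
  · exact fun h => Or.inr (Or.inr ⟨h, rfl⟩)

theorem coneOver_deleteVert_adj {x y : X} :
    ((G.coneOver S N hN a ha k A B).deleteVert a).Adj x y ↔ G.Adj x y ∧ x ∈ S ∧ y ∈ S := by
  constructor
  · rintro ⟨h | h | h, hx, hy⟩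
    exacts [h, absurd h.1 hx, absurd h.2 hy]
  · intro h
    exact ⟨Or.inl h, fun hx => ha (hx ▸ G.left_mem h.1), fun hy => ha (hy ▸ G.right_mem h.1)⟩

theorem isInducedSubgraph_coneOver_deleteVert (hk : k ≤ G.freeLoops) :
    ((G.coneOver S N hN a ha k A B).deleteVert a).IsInducedSubgraph G S := by
  have hv : ((G.coneOver S N hN a ha k A B).deleteVert a).verts = G.verts ∩ S :=
    coneOver_verts_sdiff
  refine ⟨hv, ?_, ?_, ?_, ?_, ?_, hk⟩ <;> rw [hv]
  · intro x hx y hy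
    rw [coneOver_deleteVert_adj]
    exact and_iff_left ⟨hx.2, hy.2⟩
  · intro x hx
    exact ⟨fun h => h.1.1, fun h => ⟨⟨h, hx.2⟩, fun hxa => ha (hxa ▸ hx.1)⟩⟩
  · intro x hx
    exact ⟨fun h => h.1.1, fun h => ⟨⟨h, hx.2⟩, fun hxa => ha (hxa ▸ hx.1)⟩⟩
  · exact fun x hx => wα_coneOver (hN := hN) (ha := ha) (k := k) (A := A) (B := B) hx.1
  · exact fun x hx => wβ_coneOver (hN := hN) (ha := ha) (k := k) (A := A) (B := B) hx.1

/-- If the edges between `S` and its complement form a complete bipartite graph, then `G` is a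
composition of two graphs that extend the subgraphs induced by `S` and by its complement. -/
theorem isComposition_coneOver {S S' N N' : Set X} {hN : N ⊆ G.verts ∩ S}
    {hN' : N' ⊆ G.verts ∩ S'} (hS : ∀ x ∈ G.verts, x ∈ S ↔ x ∉ S')
    (h : ∀ x ∈ S, ∀ y ∈ S', G.Adj x y ↔ x ∈ N ∧ y ∈ N') :
    G.IsComposition (G.coneOver S N hN a ha G.freeLoops A B) (G.coneOver S' N' hN' a ha 0 A B)
      A B a := by
  refine ⟨?_, isStandardVertex_coneOver, isStandardVertex_coneOver, ?_, ?_, ?_, ?_, ?_, ?_, ?_,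
    ?_, ?_, ?_, rfl⟩
  · ext x
    simp only [coneOver, Set.mem_inter_iff, Set.mem_insert_iff, Set.mem_singleton_iff]
    have := hS x
    tauto
  · rw [Set.union_sdiff_distrib, coneOver_verts_sdiff, coneOver_verts_sdiff]
    ext x
    simp only [Set.mem_inter_iff, Set.mem_union]
    have := hS x
    tauto
  · rw [coneOver_verts_sdiff]; exact fun x hx => (and_iff_left hx.2).symm
  · rw [coneOver_verts_sdiff]; exact fun x hx => (and_iff_left hx.2).symm
  · rw [coneOver_verts_sdiff]; exact fun x hx => (and_iff_left hx.2).symm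
  · rw [coneOver_verts_sdiff]; exact fun x hx => (and_iff_left hx.2).symm
  · rw [coneOver_verts_sdiff]; exact fun x hx => (wα_coneOver hx.1).symm
  · rw [coneOver_verts_sdiff]; exact fun x hx => (wα_coneOver hx.1).symm
  · rw [coneOver_verts_sdiff]; exact fun x hx => (wβ_coneOver hx.1).symm
  · rw [coneOver_verts_sdiff]; exact fun x hx => (wβ_coneOver hx.1).symm
  · intro x y
    have hs : ∀ z, (G.coneOver S' N' hN' a ha 0 A B).Adj a z ↔ z ∈ N' := fun z =>
      ⟨fun h => coneOver_adj_apex.1 (adj_symm _ h), fun h => adj_symm _ (coneOver_adj_apex.2 h)⟩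
    rw [coneOver_deleteVert_adj, coneOver_deleteVert_adj, coneOver_adj_apex, coneOver_adj_apex,
      hs, hs]
    constructor
    · intro hxy
      have hx := hS x (G.left_mem hxy)
      have hy := hS y (G.right_mem hxy)
      by_cases hxS : x ∈ S <;> by_cases hyS : y ∈ S
      · exact Or.inl ⟨hxy, hxS, hyS⟩
      · exact Or.inr (Or.inr (Or.inl ((h x hxS y (by tauto)).1 hxy)))
      · exact Or.inr (Or.inr (Or.inr ((h y hyS x (by tauto)).1 (G.adj_symm hxy))))
      · exact Or.inr (Or.inl ⟨hxy, by tauto, by tauto⟩)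
    · rintro (h' | h' | h' | h')
      · exact h'.1
      · exact h'.1
      · exact (h x (hN h'.1).2 y (hN' h'.2).2).2 h'
      · exact G.adj_symm ((h y (hN h'.1).2 x (hN' h'.2).2).2 h')

end MarkedGraph

/-! ### The two claims for link diagrams -/

namespace LinkDiagram

variable {D : LinkDiagram}

open MarkedGraph in
theorem exists_isTangleDecomposition (T : D.Tangle) (C : D.EulerSystem) {R : Type u} (A B : R)
    (α β : Plane → R) :
    ∃ (F H : MarkedGraph Plane R) (a : Plane), D.IsTangleDecomposition T C A B α β F H a := by
  set G := D.interlacementGraph C α β with hG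
  obtain ⟨a, ha⟩ : ∃ a, a ∉ G.verts := G.finite_verts.exists_notMem
  have hS : ∀ x ∈ G.verts, x ∈ T.outside ↔ x ∉ T.inside := fun x hx => T.mem_outside_iff hx
  set N : Set Plane := {x | x ∈ T.outside ∧ ∃ y ∈ T.inside, G.Adj x y} with hNdef
  set N' : Set Plane := {y | y ∈ T.inside ∧ ∃ x ∈ T.outside, G.Adj x y} with hNdef'
  have hN : N ⊆ G.verts ∩ T.outside := fun x ⟨hx, y, _, h⟩ => ⟨G.left_mem h, hx⟩
  have hN' : N' ⊆ G.verts ∩ T.inside := fun y ⟨hy, x, _, h⟩ => ⟨G.right_mem h, hy⟩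
  -- The apex is joined to the crossings that have a neighbour on the other side. All free loops are
  -- assigned to `F`; only their total matters.
  refine ⟨G.coneOver T.outside N hN a ha G.freeLoops A B, G.coneOver T.inside N' hN' a ha 0 A B,
    a, isComposition_coneOver hS ?_, isInducedSubgraph_coneOver_deleteVert le_rfl,
    isInducedSubgraph_coneOver_deleteVert (Nat.zero_le _)⟩
  intro x hx y hy
  refine ⟨fun h => ⟨⟨hx, y, hy, h⟩, hy, x, hx, h⟩, ?_⟩
  rintro ⟨⟨-, y', hy', h⟩, -, x', hx', h'⟩
  exact G.adj_symm (interlacementGraph_adj_of_tangle T C α β hy hy'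
    ((hS x' (G.left_mem h')).1 hx') ((hS x (G.left_mem h)).1 hx) (G.adj_symm h') (G.adj_symm h))

/-- A neighbour of `a` in `F` and one in `H` are adjacent in the composition, hence interlaced, so
they cannot both be marked. -/
theorem IsTangleDecomposition.noMarkedNeighbor {T : D.Tangle} {C : D.EulerSystem} {R : Type u}
    {A B : R} {α β : Plane → R} {F H : MarkedGraph Plane R} {a : Plane}
    (h : D.IsTangleDecomposition T C A B α β F H a)
    (hC : ∀ x y, x.1 ∈ D.markedCrossings C → y.1 ∈ D.markedCrossings C → ¬ C.Interlaced x y) :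
    F.NoMarkedNeighbor a ∨ H.NoMarkedNeighbor a := by
  by_contra hcon
  simp only [MarkedGraph.NoMarkedNeighbor, not_or, not_forall, not_not] at hcon
  obtain ⟨⟨x, hx, hxa⟩, y, hy, hya⟩ := hcon
  have hc := h.composition
  have hxa' : x ≠ a := by rintro rfl; exact F.adj_irrefl x hxa
  have hya' : y ≠ a := by rintro rfl; exact H.adj_irrefl y hya
  obtain ⟨hxc, hyc, hxy⟩ :=
    (hc.adj_iff x y).2 (Or.inr (Or.inr (Or.inl ⟨hxa, H.adj_symm hya⟩)))
  exact hC ⟨x, hxc⟩ ⟨y, hyc⟩ ((hc.left_marked x ⟨F.left_mem hxa, hxa'⟩).2 hx)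
    ((hc.right_marked y ⟨H.left_mem hya, hya'⟩).2 hy) hxy

end LinkDiagram

theorem theorem3 (D : LinkDiagram) (T : D.Tangle) :
    (∀ (C : D.EulerSystem) (R : Type u) [CommRing R] (A B : R) (α β : Plane → R),
      ∃ (F H : MarkedGraph Plane R) (a : Plane),
        D.IsTangleDecomposition T C A B α β F H a) ∧
    (∃ C : D.EulerSystem, ∀ (R : Type u) [CommRing R] (A B : R) (α β : Plane → R)
      (F H : MarkedGraph Plane R) (a : Plane),
        D.IsTangleDecomposition T C A B α β F H a →
          F.NoMarkedNeighbor a ∨ H.NoMarkedNeighbor a) := by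
  obtain ⟨C, hC⟩ := D.exists_eulerSystem_marked_not_interlaced
  exact ⟨fun C R _ A B α β => D.exists_isTangleDecomposition T C A B α β,
    C, fun R _ A B α β F H a h => h.noMarkedNeighbor hC⟩
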